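/- Theorem 5.1. Let $E\subseteq F$ and $E'\subseteq F'$ be smooth countable Borel equivalence relations on standard Borel spaces $X$ and $Y$, respectively. (An equivalence relation is countable if each of its classes is countable. It is smooth if it is Borel reducible to equality on $\mathbb{R}$, where a function $f$ is a reduction from $E$ to $E'$ if $x\mathrel{E}y\Leftrightarrow f(x)\mathrel{E'}f(y)$ for all $x,y$.) The pair $(E,F)$ is simultaneously Borel reducible to $(E',F')$, written $(E,F)\le_B(E',F')$, if there is a Borel function $f:X\to Y$ that is both a reduction from $E$ to $E'$ and a reduction from $F$ to $F'$. Write $(E,F)\sim_B(E',F')$ if $(E,F)\le_B(E',F')$ and $(E',F')\le_B(E,F)$. For $1\le m\le\omega$ let $n_{\ge m}(E,F)$ be the cardinal number of the set of $F$-classes that contain at least $m$ many $E$-classes. The coarse relative shape of $(E,F)$ is the sequence $\mathrm{crs}(E,F)=\langle n_{\ge m}(E,F) : 1\le m\le\omega\rangle$, and such sequences are compared termwise. Then $(E,F)\le_B(E',F')$ if and only if $\mathrm{crs}(E,F)\le\mathrm{crs}(E',F')$. In particular, $(E,F)\sim_B(E',F')$ if and only if $\mathrm{crs}(E,F)=\mathrm{crs}(E',F')$.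 -/

import Mathlib

universe u v

namespace BorelPairs


/-- An equivalence relation is countable if each of its classes is a countable set. -/
def IsCountable {X : Type u} (E : Setoid X) : Prop :=
  ∀ x : X, {y : X | E x y}.Countable

/-- A reduction from `E` to `E'`: a function `f` with `x E y ↔ f x E' f y`. -/
def IsReduction {X : Type u} {Y : Type v} (E : Setoid X) (E' : Setoid Y) (f : X → Y) : Prop :=
  ∀ x y : X, E x y ↔ E' (f x) (f y)

/-- An equivalence relation on a (standard Borel) space is smooth if it is Borel reducible to
equality of reals. In particular it is then a Borel subset of the product. -/
def IsSmooth {X : Type u} [MeasurableSpace X] (E : Setoid X) : Prop :=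
  ∃ g : X → ℝ, Measurable g ∧ IsReduction E (⊥ : Setoid ℝ) g

/-- `(E, F)` is simultaneously Borel reducible to `(E', F')`: a single Borel function is both a
reduction from `E` to `E'` and a reduction from `F` to `F'`. -/
def SimReducible {X : Type u} {Y : Type v} [MeasurableSpace X] [MeasurableSpace Y]
    (E F : Setoid X) (E' F' : Setoid Y) : Prop :=
  ∃ f : X → Y, Measurable f ∧ IsReduction E E' f ∧ IsReduction F F' f

/-- Simultaneous Borel bireducibility of pairs. -/
def SimBireducible {X : Type u} {Y : Type v} [MeasurableSpace X] [MeasurableSpace Y]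
    (E F : Setoid X) (E' F' : Setoid Y) : Prop :=
  SimReducible E F E' F' ∧ SimReducible E' F' E F

/-- The `F`-classes that contain at least `m` many `E`-classes, where `m` may be `ω` (that is,
`⊤`), in which case the condition is to contain infinitely many `E`-classes. -/
def classesWithAtLeast {X : Type u} (E F : Setoid X) (m : ℕ∞) : Set (Set X) :=
  {C : Set X | C ∈ F.classes ∧ m ≤ {D : Set X | D ∈ E.classes ∧ D ⊆ C}.encard}

/-- The coarse (relative) shape of `(E, F)`: the sequence, indexed by `1 ≤ m ≤ ω`, of the
cardinal numbers of `F`-classes that contain at least `m` many `E`-classes. -/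
noncomputable def crs {X : Type u} (E F : Setoid X) : {m : ℕ∞ // 1 ≤ m} → Cardinal.{u} :=
  fun m => Cardinal.mk (classesWithAtLeast E F m.1)

end BorelPairs

/-! On nonempty spaces each pair gets Borel coordinates (`exists_isCoding`): real labels for the
F-classes, a gap-free numbering of the E-classes inside each F-class, and Borel sections. The shape
is then carried by `level`, which counts the E-classes over a label, and `crs` lists the
cardinalities of its superlevel sets.

A simultaneous reduction injects the E-classes of an F-class into those of one F'-class, and
distinct F-classes go to distinct F'-classes; hence the inequality. Conversely, the inequality
yields a Borel map φ of labels, injective on labels in use and never lowering `level`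
(`exists_measurable_matching`); the n-th class over r is then sent to the n-th class over φ(r). Only
countably many labels have countably many candidates, and Hall's theorem matches these; the others
have uncountable Borel sets to move into.

The sections rest on Lusin–Novikov (`exists_measurable_nat_of_countable_fibers`): if the space were
not a countable union of Borel sets on which g is injective, a fusion of splittings would put a
Cantor set into one fiber. -/

namespace BorelPairs

open MeasureTheory Set Filter Topology

/-! ### Enlarging analytic sets of injectivity to Borel ones -/

section Separation

/-- The points that share their `g`-value with a different point of `A`. -/
def otherFiberPoints {X : Type u} (g : X → ℝ) (A : Set X) : Set X :=
  Prod.fst '' ({p : X × X | g p.1 = g p.2 ∧ p.1 ≠ p.2} ∩ Prod.snd ⁻¹' A)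

theorem mem_otherFiberPoints {X : Type u} {g : X → ℝ} {A : Set X} {x : X} :
    x ∈ otherFiberPoints g A ↔ ∃ y ∈ A, g x = g y ∧ x ≠ y := by
  constructor
  · rintro ⟨⟨a, b⟩, ⟨⟨h1, h2⟩, h3⟩, rfl⟩
    exact ⟨b, h3, h1, h2⟩
  · rintro ⟨y, hy, h1, h2⟩
    exact ⟨(x, y), ⟨⟨h1, h2⟩, hy⟩, rfl⟩

variable {X : Type u} [TopologicalSpace X] [PolishSpace X] [MeasurableSpace X] [BorelSpace X]

theorem analyticSet_otherFiberPoints {g : X → ℝ} (hg : Measurable g) {A : Set X}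
    (hA : AnalyticSet A) : AnalyticSet (otherFiberPoints g A) := by
  refine AnalyticSet.image_of_continuous ?_ continuous_fst
  have hm : MeasurableSet {p : X × X | g p.1 = g p.2 ∧ p.1 ≠ p.2} :=
    (measurableSet_eq_fun (hg.comp measurable_fst) (hg.comp measurable_snd)).inter
      (measurableSet_eq_fun measurable_fst measurable_snd).compl
  rw [inter_eq_iInter]
  refine AnalyticSet.iInter fun b => ?_
  cases b
  · exact hA.preimage continuous_snd
  · exact hm.analyticSet

/-- An analytic set on which `g` is injective is contained in a Borel set on which `g` is
injective. -/
theorem exists_measurableSet_injOn_superset {g : X → ℝ} (hg : Measurable g) {A : Set X}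
    (hA : AnalyticSet A) (hinj : InjOn g A) : ∃ B, A ⊆ B ∧ MeasurableSet B ∧ InjOn g B := by
  obtain ⟨u, hAu, hu, hum⟩ :=
    hA.measurablySeparable (analyticSet_otherFiberPoints hg hA) (by
      rw [Set.disjoint_left]
      intro x hx hx'
      obtain ⟨y, hy, h1, h2⟩ := mem_otherFiberPoints.1 hx'
      exact h2 (hinj hx hy h1))
  -- So far `u` only avoids collisions with points of `A`. Hence `A` misses `otherFiberPoints g u`,
  -- and a second separation removes collisions inside `u`.
  obtain ⟨v, hAv, hv, hvm⟩ :=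
    hA.measurablySeparable (analyticSet_otherFiberPoints hg hum.analyticSet) (by
      rw [Set.disjoint_left]
      intro x hx hx'
      obtain ⟨y, hy, h1, h2⟩ := mem_otherFiberPoints.1 hx'
      exact Set.disjoint_left.1 hu (mem_otherFiberPoints.2 ⟨x, hx, h1.symm, h2.symm⟩) hy)
  refine ⟨u ∩ v, subset_inter hAu hAv, hum.inter hvm, ?_⟩
  intro x hx y hy hxy
  by_contra hne
  exact Set.disjoint_left.1 hv (mem_otherFiberPoints.2 ⟨y, hy.1, hxy, hne⟩) hx.2

end Separation

/-! ### Negligible sequences of sets and their splittings -/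

section Approximations

/-- A countable union of Borel sets on each of which `g` is injective. -/
def IsSigmaInj {X : Type u} [MeasurableSpace X] (g : X → ℝ) (B : Set X) : Prop :=
  ∃ S : Set (Set X), S.Countable ∧ (∀ s ∈ S, MeasurableSet s ∧ InjOn g s) ∧ B = ⋃₀ S

theorem IsSigmaInj.iUnion {X : Type u} [MeasurableSpace X] {g : X → ℝ} {ι : Type*} [Countable ι]
    {B : ι → Set X} (hB : ∀ i, IsSigmaInj g (B i)) : IsSigmaInj g (⋃ i, B i) := by
  choose S hS hS' hBS using hB
  refine ⟨⋃ i, S i, countable_iUnion hS, ?_, ?_⟩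
  · intro s hs
    obtain ⟨i, hi⟩ := mem_iUnion.1 hs
    exact hS' i s hi
  · rw [sUnion_iUnion]
    exact iUnion_congr hBS

theorem IsSigmaInj.of_injOn {X : Type u} [MeasurableSpace X] {g : X → ℝ} {B : Set X}
    (hB : MeasurableSet B) (hg : InjOn g B) : IsSigmaInj g B :=
  ⟨{B}, countable_singleton B, by rintro s rfl; exact ⟨hB, hg⟩, by simp⟩

theorem IsSigmaInj.measurableSet {X : Type u} [MeasurableSpace X] {g : X → ℝ} {B : Set X}
    (hB : IsSigmaInj g B) : MeasurableSet B := by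
  obtain ⟨S, hS, hS', rfl⟩ := hB
  exact MeasurableSet.sUnion hS fun s hs => (hS' s hs).1

theorem IsSigmaInj.union {X : Type u} [MeasurableSpace X] {g : X → ℝ} {B C : Set X}
    (hB : IsSigmaInj g B) (hC : IsSigmaInj g C) : IsSigmaInj g (B ∪ C) := by
  rw [union_eq_iUnion]
  exact IsSigmaInj.iUnion fun b => by cases b <;> assumption

/-- A finite sequence of points of one fiber of `g`, chosen from the sets `U i`. -/
def IsFiberChoice {X : Type u} (g : X → ℝ) {n : ℕ} (U : Fin n → Set X) (c : Fin n → X) : Prop :=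
  (∀ i, c i ∈ U i) ∧ ∀ i j, g (c i) = g (c j)

/-- A finite sequence of sets is negligible if some countable union of Borel sets on which `g` is
injective meets all choices of points from one fiber in these sets. -/
def IsNegligible {X : Type u} [MeasurableSpace X] (g : X → ℝ) {n : ℕ} (U : Fin n → Set X) : Prop :=
  ∃ B, IsSigmaInj g B ∧ ∀ c, IsFiberChoice g U c → ∃ i, c i ∈ B

theorem exists_isFiberChoice {X : Type u} [MeasurableSpace X] {g : X → ℝ} {n : ℕ} {U : Fin n → Set X} (hU : ¬ IsNegligible g U) :
    ∃ c, IsFiberChoice g U c := by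
  by_contra! hcon
  exact hU ⟨∅, ⟨∅, countable_empty, by simp, by simp⟩, fun c hc => (hcon c hc).elim⟩

/-- `V` refines `U`, its additional last member being a piece of `U i` apart from `V i`. -/
structure IsSplitting {X : Type u} [MetricSpace X] {n : ℕ} (ε : ℝ) (i : Fin n) (U : Fin n → Set X)
    (V : Fin (n + 1) → Set X) : Prop where
  isOpen : ∀ j, IsOpen (V j)
  closure_castSucc : ∀ j : Fin n, closure (V j.castSucc) ⊆ U j
  closure_last : closure (V (Fin.last n)) ⊆ U i
  disjoint : Disjoint (V i.castSucc) (V (Fin.last n))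
  dist_lt : ∀ j, ∀ x ∈ V j, ∀ y ∈ V j, dist x y < ε

variable {X : Type u} [MetricSpace X] [SecondCountableTopology X]

/-- Taking the pieces from a countable basis leaves only countably many splittings to consider. -/
theorem exists_isSplitting_of_points {n : ℕ} {ε : ℝ} (hε : 0 < ε) {i : Fin n} {U : Fin n → Set X}
    (hU : ∀ j, IsOpen (U j)) {c : Fin n → X} (hc : ∀ j, c j ∈ U j) {x : X} (hx : x ∈ U i)
    (hne : c i ≠ x) :
    ∃ V, IsSplitting ε i U V ∧ (∀ j, V j ∈ TopologicalSpace.countableBasis X) ∧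
      ∀ j, (Fin.snoc c x : Fin (n + 1) → X) j ∈ V j := by
  obtain ⟨O, O', hO, hO', hcO, hxO', hOO'⟩ := t2_separation hne
  let N : Fin (n + 1) → Set X :=
    Fin.snoc (fun j => (U j ∩ {y | j = i → y ∈ O}) ∩ Metric.ball (c j) (ε / 2))
      ((U i ∩ O') ∩ Metric.ball x (ε / 2))
  have hN : ∀ j, N j ∈ 𝓝 ((Fin.snoc c x : Fin (n + 1) → X) j) := by
    intro j
    refine Fin.lastCases ?_ (fun j => ?_) j
    · simp only [N, Fin.snoc_last]
      exact inter_mem (inter_mem ((hU i).mem_nhds hx) (hO'.mem_nhds hxO'))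
        (Metric.ball_mem_nhds _ (by positivity))
    · simp only [N, Fin.snoc_castSucc]
      refine inter_mem (inter_mem ((hU j).mem_nhds (hc j)) ?_)
        (Metric.ball_mem_nhds _ (by positivity))
      by_cases hji : j = i
      · subst hji
        simpa using hO.mem_nhds hcO
      · simp [hji]
  choose V hVb hcV hVN using fun j =>
    (TopologicalSpace.isBasis_countableBasis X).exists_closure_subset (hN j)
  have hcast : ∀ j : Fin n, closure (V j.castSucc) ⊆
      (U j ∩ {y | j = i → y ∈ O}) ∩ Metric.ball (c j) (ε / 2) := fun j => by
    simpa only [N, Fin.snoc_castSucc] using hVN j.castSucc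
  have hlast : closure (V (Fin.last n)) ⊆ (U i ∩ O') ∩ Metric.ball x (ε / 2) := by
    simpa only [N, Fin.snoc_last] using hVN (Fin.last n)
  have hball : ∀ {a y z : X}, y ∈ Metric.ball a (ε / 2) → z ∈ Metric.ball a (ε / 2) →
      dist y z < ε := fun hy hz => by
    rw [Metric.mem_ball] at hy hz
    exact (dist_triangle_right _ _ _).trans_lt (by linarith)
  refine ⟨V, ⟨fun j => (TopologicalSpace.isBasis_countableBasis X).isOpen (hVb j),
    fun j y hy => (hcast j hy).1.1, fun y hy => (hlast hy).1.1, ?_, fun j => ?_⟩, hVb, hcV⟩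
  · rw [Set.disjoint_left]
    intro y hy hy'
    exact Set.disjoint_left.1 hOO' ((hcast i (subset_closure hy)).1.2 rfl)
      (hlast (subset_closure hy')).1.2
  · refine Fin.lastCases (fun y hy z hz => ?_) (fun j y hy z hz => ?_) j
    · exact hball (hlast (subset_closure hy)).2 (hlast (subset_closure hz)).2
    · exact hball (hcast j (subset_closure hy)).2 (hcast j (subset_closure hz)).2

variable [CompleteSpace X] [MeasurableSpace X] [BorelSpace X]

/-- If all splittings were negligible, let `C` unite the witnesses of the basic ones. Two choices
avoiding `C`, in the same fiber but with different `i`-th points, would combine into a choice for a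
basic splitting that avoids its witness. So `g` is injective on the `i`-th points of such choices,
and a Borel set of injectivity around these, joined to `C`, makes `U` negligible. -/
theorem exists_isSplitting_not_isNegligible {g : X → ℝ} (hg : Continuous g) {n : ℕ} {ε : ℝ}
    (hε : 0 < ε) (i : Fin n) {U : Fin n → Set X} (hU : ∀ j, IsOpen (U j))
    (hneg : ¬ IsNegligible g U) : ∃ V, IsSplitting ε i U V ∧ ¬ IsNegligible g V := by
  by_contra! hcon
  let S : Set (Fin (n + 1) → Set X) :=
    {V | IsSplitting ε i U V ∧ ∀ j, V j ∈ TopologicalSpace.countableBasis X}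
  have hS : S.Countable :=
    (Set.countable_pi fun _ => TopologicalSpace.countable_countableBasis X).mono
      fun V hV => hV.2
  have : Countable S := hS.to_subtype
  choose B hB hBc using fun V : S => hcon V.1 V.2.1
  let C : Set X := ⋃ V, B V
  have hC : IsSigmaInj g C := IsSigmaInj.iUnion hB
  let T : Set (Fin n → X) := {c | IsFiberChoice g U c ∧ ∀ j, c j ∉ C}
  have hT : MeasurableSet T := by
    have : T = (⋂ j, (fun c : Fin n → X => c j) ⁻¹' (U j \ C)) ∩
        ⋂ j, ⋂ k, {c | g (c j) = g (c k)} := by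
      ext c
      simp only [T, IsFiberChoice, mem_ofPred_eq, mem_inter_iff, mem_iInter, mem_preimage, Set.mem_sdiff]
      exact ⟨fun h => ⟨fun j => ⟨h.1.1 j, h.2 j⟩, h.1.2⟩,
        fun h => ⟨⟨fun j => (h.1 j).1, h.2⟩, fun j => (h.1 j).2⟩⟩
    rw [this]
    refine (MeasurableSet.iInter fun j => ?_).inter
      (MeasurableSet.iInter fun j => MeasurableSet.iInter fun k => ?_)
    · exact measurable_pi_apply j ((hU j).measurableSet.diff hC.measurableSet)
    · exact measurableSet_eq_fun (hg.measurable.comp (measurable_pi_apply j))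
        (hg.measurable.comp (measurable_pi_apply k))
  have hA : AnalyticSet ((fun c : Fin n → X => c i) '' T) :=
    hT.analyticSet.image_of_continuous (continuous_apply i)
  have hinj : InjOn g ((fun c : Fin n → X => c i) '' T) := by
    rintro _ ⟨c, hc, rfl⟩ _ ⟨d, hd, rfl⟩ hcd
    by_contra hne
    obtain ⟨V, hV, hVb, hcV⟩ := exists_isSplitting_of_points hε hU hc.1.1 (hd.1.1 i) hne
    obtain ⟨j, hj⟩ := hBc ⟨V, hV, hVb⟩ (Fin.snoc c (d i)) ⟨hcV, by
      have : ∀ j, g ((Fin.snoc c (d i) : Fin (n + 1) → X) j) = g (c i) := fun j => by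
        refine Fin.lastCases ?_ (fun j => ?_) j
        · simpa using hcd.symm
        · simpa using hc.1.2 j i
      exact fun j k => (this j).trans (this k).symm⟩
    revert hj
    refine Fin.lastCases (fun hj => ?_) (fun j hj => ?_) j
    · rw [Fin.snoc_last] at hj
      exact hd.2 i (mem_iUnion.2 ⟨_, hj⟩)
    · rw [Fin.snoc_castSucc] at hj
      exact hc.2 j (mem_iUnion.2 ⟨_, hj⟩)
  obtain ⟨D, hAD, hD, hDinj⟩ := exists_measurableSet_injOn_superset hg.measurable hA hinj
  refine hneg ⟨C ∪ D, hC.union (IsSigmaInj.of_injOn hD hDinj), fun c hc => ?_⟩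
  by_contra! hcon'
  exact hcon' i (Or.inr (hAD ⟨c, ⟨hc, fun j hj => hcon' j (Or.inl hj)⟩, rfl⟩))

end Approximations

/-! ### Fusion: a perfect set inside one fiber -/

section Fusion

variable {X : Type u} [MetricSpace X]

theorem isSplitting_seq_mem {V : ∀ n : ℕ, Fin (n + 1) → Set X} {ε : ℕ → ℝ}
    {i : ∀ n : ℕ, Fin (n + 1)} (hV : ∀ n, IsSplitting (ε n) (i n) (V n) (V (n + 1))) {j n m : ℕ}
    (hj : j ≤ n) (hnm : n ≤ m) :
    V m ⟨j, by omega⟩ ⊆ V n ⟨j, by omega⟩ := by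
  induction m, hnm using Nat.le_induction with
  | base => exact subset_rfl
  | succ m hm ih =>
    exact (subset_closure.trans ((hV m).closure_castSucc ⟨j, by omega⟩)).trans ih

variable [CompleteSpace X]

/-- The limit of an infinite sequence of splittings is a sequence of points in one fiber, each of
which is a limit of other ones. -/
theorem exists_preperfect_of_isSplitting_seq {g : X → ℝ} (hg : Continuous g)
    {V : ∀ n : ℕ, Fin (n + 1) → Set X} {i : ∀ n : ℕ, Fin (n + 1)}
    (hi : ∀ j n : ℕ, ∃ m, n ≤ m ∧ (i m : ℕ) = j)
    (hV : ∀ n : ℕ, IsSplitting (1 / ((n : ℝ) + 1)) (i n) (V n) (V (n + 1)))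
    (hc : ∀ n, ∃ c, IsFiberChoice g (V n) c) :
    ∃ x : ℕ → X, (∀ j, g (x j) = g (x 0)) ∧ Preperfect (range x) := by
  choose c hcV hcg using hc
  -- The `min` is a filler for the stages `m < j`, where there is no `j`-th point yet; the limits
  -- ignore it.
  let q : ℕ → ℕ → X := fun j m => c m ⟨min j m, by omega⟩
  have hq : ∀ {j n m : ℕ}, (hj : j ≤ n) → n ≤ m → q j m ∈ V n ⟨j, by omega⟩ := by
    intro j n m hj hnm
    refine isSplitting_seq_mem hV hj hnm ?_
    have : (⟨min j m, by omega⟩ : Fin (m + 1)) = ⟨j, by omega⟩ := by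
      ext; simp; omega
    simp only [q, this]
    exact hcV m _
  have hlim : ∀ j, ∃ x, Tendsto (q j) atTop (𝓝 x) := by
    intro j
    refine cauchySeq_tendsto_of_complete (Metric.cauchySeq_iff.2 fun ε hε => ?_)
    obtain ⟨N, hN⟩ := exists_nat_one_div_lt hε
    refine ⟨max j N + 1, fun m hm n hn => ?_⟩
    refine ((hV (max j N)).dist_lt ⟨j, by omega⟩ _ (hq (by omega) hm) _ (hq (by omega) hn)).trans
      (lt_of_le_of_lt ?_ hN)
    have : (N : ℝ) ≤ ((max j N : ℕ) : ℝ) := by exact_mod_cast le_max_right j N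
    exact one_div_le_one_div_of_le (by positivity) (by linarith)
  choose x hx using hlim
  have hxV : ∀ {j n : ℕ}, (hj : j ≤ n) → x j ∈ V n ⟨j, by omega⟩ := by
    intro j n hj
    refine (hV n).closure_castSucc ⟨j, by omega⟩ ?_
    exact mem_closure_of_tendsto (hx j) (eventually_atTop.2 ⟨n + 1, fun m hm => hq (by omega) hm⟩)
  refine ⟨x, fun j => ?_, ?_⟩
  · refine tendsto_nhds_unique ((hg.tendsto _).comp (hx j)) ?_
    refine ((hg.tendsto _).comp (hx 0)).congr fun m => ?_
    exact hcg m _ _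
  · rintro _ ⟨j, rfl⟩
    rw [accPt_iff_nhds]
    intro O hO
    obtain ⟨ε, hε, hεO⟩ := Metric.mem_nhds_iff.1 hO
    obtain ⟨N, hN⟩ := exists_nat_one_div_lt hε
    -- The `+ 1` makes the stage a successor: the members of `V (k + 1)` are small by `hV k`, and
    -- splitting the `j`-th one adds the new point `x (k + 2)` near `x j`.
    obtain ⟨m, hm, him⟩ := hi j (max j N + 1)
    obtain ⟨k, rfl⟩ : ∃ k, m = k + 1 := ⟨m - 1, by omega⟩
    have him' : i (k + 1) = ⟨j, by omega⟩ := Fin.ext him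
    have h1 : x (k + 2) ∈ V (k + 2) (Fin.last (k + 2)) := hxV le_rfl
    have h2 : x (k + 2) ∈ V (k + 1) ⟨j, by omega⟩ := by
      rw [← him']
      exact (hV (k + 1)).closure_last (subset_closure h1)
    refine ⟨x (k + 2), ⟨hεO ?_, mem_range_self _⟩, fun heq => ?_⟩
    · have := (hV k).dist_lt ⟨j, by omega⟩ _ h2 _ (hxV (by omega))
      refine this.trans (lt_of_le_of_lt ?_ hN)
      have : (N : ℝ) ≤ (k : ℝ) := by exact_mod_cast (by omega : N ≤ k)
      exact one_div_le_one_div_of_le (by positivity) (by linarith)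
    · have h3 : x j ∈ V (k + 2) (i (k + 1)).castSucc := by
        rw [him']
        exact hxV (by omega)
      exact Set.disjoint_left.1 (hV (k + 1)).disjoint h3 (heq ▸ h1)

variable [SecondCountableTopology X] [MeasurableSpace X] [BorelSpace X]

theorem exists_preperfect_of_not_isSigmaInj {g : X → ℝ} (hg : Continuous g)
    (hX : ¬ IsSigmaInj g (univ : Set X)) :
    ∃ x : ℕ → X, (∀ j, g (x j) = g (x 0)) ∧ Preperfect (range x) := by
  -- Unpairing takes each first coordinate infinitely often, so every member is split again and
  -- again.
  let i : ∀ n : ℕ, Fin (n + 1) := fun n => ⟨(Nat.unpair n).1, by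
    have := Nat.unpair_left_le n; omega⟩
  let A : ℕ → Type u := fun n =>
    {U : Fin (n + 1) → Set X // (∀ j, IsOpen (U j)) ∧ ¬ IsNegligible g U}
  have hA0 : ¬ IsNegligible g (fun _ : Fin (0 + 1) => (univ : Set X)) := by
    rintro ⟨B, hB, hBc⟩
    refine hX ?_
    convert hB
    refine (eq_univ_of_forall fun y => ?_).symm
    obtain ⟨k, hk⟩ := hBc (fun _ => y) ⟨fun _ => mem_univ _, fun _ _ => rfl⟩
    exact hk
  have step : ∀ n : ℕ, ∀ U : A n, ∃ V : A (n + 1),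
      IsSplitting (1 / ((n : ℝ) + 1)) (i n) U.1 V.1 := by
    rintro n ⟨U, hU, hneg⟩
    obtain ⟨V, hV, hVneg⟩ := exists_isSplitting_not_isNegligible hg
      (by positivity : (0 : ℝ) < 1 / ((n : ℝ) + 1)) (i n) hU hneg
    exact ⟨⟨V, hV.isOpen, hVneg⟩, hV⟩
  choose next hnext using step
  let W : ∀ n, A n := fun n => Nat.rec ⟨fun _ => univ, fun _ => isOpen_univ, hA0⟩ next n
  refine exists_preperfect_of_isSplitting_seq hg (V := fun n => (W n).1) (i := i) ?_
    (fun n => hnext n (W n)) (fun n => exists_isFiberChoice (W n).2.2)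
  intro j n
  exact ⟨Nat.pair j n, Nat.right_le_pair j n, by simp [i]⟩

/-- Otherwise the closure of the preperfect sequence is a nonempty perfect subset of a closed fiber,
which is then uncountable. -/
theorem isSigmaInj_univ_of_continuous {g : X → ℝ} (hg : Continuous g)
    (hc : ∀ r, (g ⁻¹' {r}).Countable) : IsSigmaInj g (univ : Set X) := by
  by_contra hX
  obtain ⟨x, hxg, hx⟩ := exists_preperfect_of_not_isSigmaInj hg hX
  obtain ⟨f, hf, -, hinj⟩ := hx.perfect_closure.exists_nat_bool_injection
    ((range_nonempty x).mono subset_closure)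
  have hsub : range f ⊆ g ⁻¹' {g (x 0)} := hf.trans
    (closure_minimal (by rintro _ ⟨j, rfl⟩; exact hxg j) (isClosed_singleton.preimage hg))
  have h1 : (range f).Countable := (hc _).mono hsub
  have h2 : Countable (ℕ → Bool) := by
    have := h1.preimage hinj
    rwa [preimage_range, countable_univ_iff] at this
  obtain ⟨e, he⟩ := h2
  classical
  refine Function.cantor_injective (fun s : Set ℕ => e fun n => decide (n ∈ s)) fun s t hst => ?_
  ext n
  simpa using congrFun (he hst) n

end Fusion

/-! ### Lusin–Novikov for Borel functions -/

/-- **Lusin–Novikov**: a countable-to-one Borel function is injective on each piece of a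
countable Borel partition of its domain. -/
theorem exists_measurable_nat_of_countable_fibers {X : Type u} [MeasurableSpace X]
    [StandardBorelSpace X] {g : X → ℝ} (hg : Measurable g) (hc : ∀ r, (g ⁻¹' {r}).Countable) :
    ∃ i : X → ℕ, Measurable i ∧ ∀ x y, g x = g y → i x = i y → x = y := by
  classical
  obtain ⟨τ, hB, hP⟩ := StandardBorelSpace.polish (α := X)
  -- A finer Polish topology with the same Borel sets makes `g` continuous.
  obtain ⟨τ', hle, hgc, hP'⟩ := hg.exists_continuous
  have hB' : @BorelSpace X τ' _ := by
    have hb := hB.measurable_eq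
    refine @BorelSpace.mk X τ' _ (hb.trans ?_)
    exact (borel_eq_borel_of_le hP' hP hle).symm
  obtain ⟨S, hS, hS', hu⟩ : IsSigmaInj g (univ : Set X) := by
    let := τ'
    let := TopologicalSpace.upgradeIsCompletelyMetrizable X
    exact isSigmaInj_univ_of_continuous hgc hc
  obtain ⟨B, hBm, hBu⟩ : ∃ B : ℕ → Set X, (∀ n, MeasurableSet (B n) ∧ InjOn g (B n)) ∧
      ∀ x, ∃ n, x ∈ B n := by
    rcases S.eq_empty_or_nonempty with rfl | hne
    · refine ⟨fun _ => ∅, fun _ => ⟨MeasurableSet.empty, injOn_empty g⟩, fun x => ?_⟩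
      have := hu ▸ mem_univ x
      simp at this
    · obtain ⟨B, hB⟩ := hS.exists_eq_range hne
      refine ⟨B, fun n => hS' _ (hB ▸ mem_range_self n), fun x => ?_⟩
      obtain ⟨s, hs, hxs⟩ := mem_sUnion.1 (hu ▸ mem_univ x)
      obtain ⟨n, rfl⟩ := hB ▸ hs
      exact ⟨n, hxs⟩
  refine ⟨fun x => Nat.find (hBu x), measurable_find hBu fun k => (hBm k).1, ?_⟩
  intro x y hxy hi
  have hi' : Nat.find (hBu x) = Nat.find (hBu y) := hi
  exact (hBm _).2 (Nat.find_spec (hBu x)) (hi' ▸ Nat.find_spec (hBu y)) hxy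

/-! ### Borel coordinates -/

/-- Borel coordinates for a pair `E ⊆ F`: `h` labels the `F`-classes by reals, `j` numbers the
`E`-classes within each `F`-class without gaps, and `s n r` is a point of the `n`-th `E`-class in
the `F`-class with label `r`, if there is one. -/
structure IsCoding {X : Type u} [MeasurableSpace X] (E F : Setoid X) (h : X → ℝ) (j : X → ℕ)
    (s : ℕ → ℝ → X) : Prop where
  measurable_label : Measurable h
  measurable_index : Measurable j
  measurable_section : ∀ n, Measurable (s n)
  rel_coarse : ∀ x y, F x y ↔ h x = h y
  rel_fine : ∀ x y, E x y ↔ h x = h y ∧ j x = j y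
  exists_index : ∀ x n, n < j x → ∃ y, h y = h x ∧ j y = n
  measurableSet_labels : ∀ n, MeasurableSet (h '' (j ⁻¹' {n}))
  label_section : ∀ x, h (s (j x) (h x)) = h x
  index_section : ∀ x, j (s (j x) (h x)) = j x

theorem exists_count_eq_of_lt_count {p : ℕ → Prop} [DecidablePred p] {n N : ℕ}
    (h : n < Nat.count p N) : ∃ k, p k ∧ Nat.count p k = n := by
  induction N with
  | zero => simp at h
  | succ N ih =>
    by_cases hN : n < Nat.count p N
    · exact ih hN
    · rw [Nat.count_succ] at h
      split_ifs at h with hp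
      · exact ⟨N, hp, by omega⟩
      · omega

theorem measurable_count {α : Type*} [MeasurableSpace α] {p : α → ℕ → Prop}
    [∀ a, DecidablePred (p a)] (hp : ∀ k, MeasurableSet {a | p a k}) (n : ℕ) :
    Measurable fun a => Nat.count (p a) n := by
  induction n with
  | zero => simp
  | succ n ih =>
    simp only [Nat.count_succ]
    exact ih.add (Measurable.ite (hp n) measurable_const measurable_const)

/-- A countable-to-one Borel function to the reals has countably many partial Borel right
inverses with Borel domains `V k` that together exhaust the fibers. -/
theorem exists_measurable_rightInverses {X : Type u} [MeasurableSpace X] [StandardBorelSpace X]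
    [Nonempty X] {h : X → ℝ} (hh : Measurable h) (hc : ∀ r, (h ⁻¹' {r}).Countable) :
    ∃ (V : ℕ → Set ℝ) (y : ℕ → ℝ → X), (∀ k, MeasurableSet (V k)) ∧ (∀ k, Measurable (y k)) ∧
      (∀ k, ∀ r ∈ V k, h (y k r) = r) ∧ ∀ x, ∃ k, h x ∈ V k ∧ y k (h x) = x := by
  obtain ⟨i, hi, hinj⟩ := exists_measurable_nat_of_countable_fibers hh hc
  have hm : ∀ k, MeasurableSet (i ⁻¹' {k}) := fun k => hi (measurableSet_singleton k)
  have hio : ∀ k, InjOn h (i ⁻¹' {k}) := fun k x hx y hy hxy => hinj x y hxy (hx.trans hy.symm)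
  have hext : ∀ k, ∃ y : ℝ → X, Measurable y ∧ ∀ x, i x = k → y (h x) = x := by
    intro k
    have : StandardBorelSpace (i ⁻¹' {k}) := (hm k).standardBorel
    -- By Lusin–Souslin the inverse on this piece is Borel; its extension to the whole line takes
    -- arbitrary values off the image.
    have he : MeasurableEmbedding fun x : i ⁻¹' {k} => h x :=
      (hh.comp measurable_subtype_coe).measurableEmbedding fun a b hab =>
        Subtype.ext (hio k a.2 b.2 hab)
    obtain ⟨y, hy, hyc⟩ := he.exists_measurable_extend measurable_subtype_coe
      (fun _ => inferInstance)
    exact ⟨y, hy, fun x hx => congrFun hyc ⟨x, hx⟩⟩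
  choose y hy hyx using hext
  refine ⟨fun k => h '' (i ⁻¹' {k}), y, fun k => (hm k).image_of_measurable_injOn hh (hio k), hy,
    ?_, fun x => ⟨i x, ⟨x, rfl, rfl⟩, hyx _ x rfl⟩⟩
  rintro k _ ⟨x, hx, rfl⟩
  rw [hyx k x hx]

theorem exists_isCoding {X : Type u} [MeasurableSpace X] [StandardBorelSpace X] [Nonempty X]
    {E F : Setoid X} (hEF : E ≤ F) (hE : IsSmooth E) (hF : IsSmooth F) (cF : IsCountable F) :
    ∃ h j s, IsCoding E F h j s := by
  classical
  obtain ⟨g, hg, hgE⟩ := hE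
  obtain ⟨h, hh, hhF⟩ := hF
  replace hgE : ∀ x y, E x y ↔ g x = g y := hgE
  replace hhF : ∀ x y, F x y ↔ h x = h y := hhF
  have hgh : ∀ {x y}, g x = g y → h x = h y := fun {x y} hxy =>
    (hhF x y).1 (hEF ((hgE x y).2 hxy))
  have hc : ∀ r, (h ⁻¹' {r}).Countable := by
    intro r
    rcases (h ⁻¹' {r}).eq_empty_or_nonempty with h0 | ⟨x, hx⟩
    · rw [h0]
      exact countable_empty
    · refine (cF x).mono fun y hy => ?_
      exact (hhF x y).2 (Eq.trans hx (Eq.symm hy))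
  obtain ⟨V, y, hV, hy, hyV, hyx⟩ := exists_measurable_rightInverses hh hc
  -- the least index of a right inverse that takes a value in the `E`-class of the point
  have hex : ∀ x, ∃ k, h x ∈ V k ∧ g (y k (h x)) = g x := fun x => by
    obtain ⟨k, hk, hkx⟩ := hyx x
    exact ⟨k, hk, by rw [hkx]⟩
  let e : X → ℕ := fun x => Nat.find (hex x)
  have he : Measurable e := measurable_find hex fun k =>
    (hh (hV k)).inter (measurableSet_eq_fun (hg.comp ((hy k).comp hh)) hg)
  have he_spec : ∀ x, h x ∈ V (e x) ∧ g (y (e x) (h x)) = g x := fun x => Nat.find_spec (hex x)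
  have he_le : ∀ {x z}, g x = g z → e x ≤ e z := by
    intro x z hxz
    refine Nat.find_min' (hex x) ?_
    rw [hxz, hgh hxz]
    exact he_spec z
  have he_eq : ∀ {x z}, g x = g z → e x = e z := fun hxz => (he_le hxz).antisymm (he_le hxz.symm)
  have he_inj : ∀ {x z}, h x = h z → e x = e z → g x = g z := by
    intro x z hxz hez
    rw [← (he_spec x).2, ← (he_spec z).2, hxz, hez]
  -- `Q r` holds at exactly the values of `e` over `r`. Counting those below `e x` closes the gaps
  -- in the numbering.
  let Q : ℝ → ℕ → Prop := fun r k => r ∈ V k ∧ e (y k r) = k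
  have hQm : ∀ k, MeasurableSet {r | Q r k} := fun k =>
    (hV k).inter ((he.comp (hy k)) (measurableSet_singleton k))
  have hQe : ∀ x, Q (h x) (e x) := fun x => ⟨(he_spec x).1, he_eq (he_spec x).2⟩
  let j : X → ℕ := fun x => Nat.count (Q (h x)) (e x)
  have hj : Measurable j :=
    (measurable_from_prod_countable_left (f := fun p : ℝ × ℕ => Nat.count (Q p.1) p.2)
      fun n => measurable_count hQm n).comp (hh.prodMk he)
  let W : ℕ → Set ℝ := fun n => ⋃ k, {r | r ∈ V k ∧ j (y k r) = n}
  have hW : ∀ n, MeasurableSet (W n) := fun n => MeasurableSet.iUnion fun k =>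
    (hV k).inter ((hj.comp (hy k)) (measurableSet_singleton n))
  have hWx : ∀ x, h x ∈ W (j x) := fun x => by
    obtain ⟨k, hk, hkx⟩ := hyx x
    exact mem_iUnion.2 ⟨k, hk, by rw [hkx]⟩
  -- The second alternative only makes the search for `k` total.
  have hWex : ∀ n r, ∃ k, (r ∈ V k ∧ j (y k r) = n) ∨ r ∉ W n := by
    intro n r
    by_cases hr : r ∈ W n
    · obtain ⟨k, hk⟩ := mem_iUnion.1 hr
      exact ⟨k, Or.inl hk⟩
    · exact ⟨0, Or.inr hr⟩
  have hs_spec : ∀ x, h x ∈ V (Nat.find (hWex (j x) (h x))) ∧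
      j (y (Nat.find (hWex (j x) (h x))) (h x)) = j x := fun x =>
    (Nat.find_spec (hWex (j x) (h x))).resolve_right (not_not_intro (hWx x))
  refine ⟨h, j, fun n r => y (Nat.find (hWex n r)) r, hh, hj, fun n => ?_, hhF, fun x z => ?_,
    fun x n hn => ?_, fun n => ?_, fun x => hyV _ _ (hs_spec x).1, fun x => (hs_spec x).2⟩
  · refine Measurable.find (p := fun k r => (r ∈ V k ∧ j (y k r) = n) ∨ r ∉ W n) hy
      (fun k => ?_) (hWex n)
    exact ((hV k).inter ((hj.comp (hy k)) (measurableSet_singleton n))).union (hW n).compl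
  · rw [hgE]
    constructor
    · intro hxz
      refine ⟨hgh hxz, ?_⟩
      simp only [j, hgh hxz, he_eq hxz]
    · rintro ⟨hxz, hjxz⟩
      refine he_inj hxz ?_
      have hz := hQe z
      simp only [j, hxz] at hjxz
      exact Nat.count_injective (hxz ▸ hQe x) hz hjxz
  · obtain ⟨k, hk, hkn⟩ := exists_count_eq_of_lt_count hn
    refine ⟨y k (h x), hyV k _ hk.1, ?_⟩
    simp only [j, hyV k _ hk.1, hk.2, hkn]
  · convert hW n using 1
    ext r
    constructor
    · rintro ⟨x, rfl, rfl⟩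
      exact hWx x
    · intro hr
      obtain ⟨k, hk, hkn⟩ := mem_iUnion.1 hr
      exact ⟨y k r, hkn, hyV k r hk⟩

/-! ### Levels of labels and the coarse shape -/

/-- The number of `E`-classes in the `F`-class with label `r`. -/
noncomputable def level {X : Type u} (h : X → ℝ) (j : X → ℕ) (r : ℝ) : ℕ∞ :=
  (j '' (h ⁻¹' {r})).encard

namespace IsCoding

variable {X : Type u} [MeasurableSpace X] {E F : Setoid X} {h : X → ℝ} {j : X → ℕ}
  {s : ℕ → ℝ → X}

/-- Without gaps, the indices over `r` form an initial segment of ℕ. This makes `level` Borel. -/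
theorem lt_level_iff (H : IsCoding E F h j s) (n : ℕ) (r : ℝ) :
    (n : ℕ∞) < level h j r ↔ r ∈ h '' (j ⁻¹' {n}) := by
  have hdown : ∀ {a b}, a ∈ j '' (h ⁻¹' {r}) → b ≤ a → b ∈ j '' (h ⁻¹' {r}) := by
    rintro _ b ⟨x, hx, rfl⟩ hb
    rcases hb.eq_or_lt with rfl | hb
    · exact ⟨x, hx, rfl⟩
    · obtain ⟨z, hz, rfl⟩ := H.exists_index x b hb
      exact ⟨z, hz.trans hx, rfl⟩
  have hmem : r ∈ h '' (j ⁻¹' {n}) ↔ n ∈ j '' (h ⁻¹' {r}) :=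
    ⟨fun ⟨x, h1, h2⟩ => ⟨x, h2, h1⟩, fun ⟨x, h1, h2⟩ => ⟨x, h2, h1⟩⟩
  rw [hmem]
  constructor
  · intro hn
    by_contra hcon
    refine hn.not_ge ?_
    have hsub : j '' (h ⁻¹' {r}) ⊆ (Finset.range n : Set ℕ) := by
      intro a ha
      rw [Finset.coe_range, mem_Iio]
      by_contra hle
      exact hcon (hdown ha (not_lt.1 hle))
    have := encard_le_encard hsub
    rwa [encard_coe_eq_coe_finsetCard, Finset.card_range] at this
  · intro hn
    have hsub : (Finset.range (n + 1) : Set ℕ) ⊆ j '' (h ⁻¹' {r}) := by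
      intro a ha
      rw [Finset.coe_range, mem_Iio] at ha
      exact hdown hn (by omega)
    have := encard_le_encard hsub
    rw [encard_coe_eq_coe_finsetCard, Finset.card_range] at this
    refine lt_of_lt_of_le ?_ this
    exact_mod_cast Nat.lt_succ_self n

theorem measurableSet_le_level (H : IsCoding E F h j s) (m : ℕ∞) :
    MeasurableSet {r | m ≤ level h j r} := by
  have : {r | m ≤ level h j r} = ⋂ n : ℕ, ⋂ _ : (n : ℕ∞) < m, h '' (j ⁻¹' {n}) := by
    ext r
    simp only [mem_iInter, ← H.lt_level_iff]
    refine ⟨fun hm n hn => hn.trans_le hm, fun hm => ?_⟩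
    by_contra hlt
    obtain ⟨k, hk⟩ := ENat.ne_top_iff_exists.1 (not_le.1 hlt).ne_top
    have hk' : (k : ℕ∞) < m := hk ▸ not_le.1 hlt
    exact (hm k hk').ne hk
  rw [this]
  exact MeasurableSet.iInter fun n => MeasurableSet.iInter fun _ => H.measurableSet_labels n

theorem measurable_level (H : IsCoding E F h j s) : Measurable (level h j) := by
  refine ENat.measurable_iff.2 fun n => ?_
  have : level h j ⁻¹' {(n : ℕ∞)} = {r | (n : ℕ∞) ≤ level h j r} \ h '' (j ⁻¹' {n}) := by
    ext r
    rw [Set.mem_sdiff, ← H.lt_level_iff, not_lt]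
    exact ⟨fun hr => ⟨(Eq.symm hr).le, (Eq.le hr)⟩, fun hr => hr.2.antisymm hr.1⟩
  rw [this]
  exact (H.measurableSet_le_level n).diff (H.measurableSet_labels n)

theorem encard_classes_eq_level (H : IsCoding E F h j s) (r : ℝ) :
    {D : Set X | D ∈ E.classes ∧ D ⊆ h ⁻¹' {r}}.encard = level h j r := by
  have : {D : Set X | D ∈ E.classes ∧ D ⊆ h ⁻¹' {r}} =
      (fun n => h ⁻¹' {r} ∩ j ⁻¹' {n}) '' (j '' (h ⁻¹' {r})) := by
    ext D
    constructor
    · rintro ⟨⟨x, rfl⟩, hD⟩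
      have hx : h x = r := hD (E.refl x)
      refine ⟨j x, ⟨x, hx, rfl⟩, ?_⟩
      ext z
      change (h z = r ∧ j z = j x) ↔ E z x
      rw [H.rel_fine, hx]
    · rintro ⟨_, ⟨x, hx, rfl⟩, rfl⟩
      refine ⟨⟨x, ?_⟩, inter_subset_left⟩
      ext z
      change (h z = r ∧ j z = j x) ↔ E z x
      rw [H.rel_fine, show h x = r from hx]
  rw [this, InjOn.encard_image, level]
  rintro _ ⟨x, hx, rfl⟩ _ ⟨z, hz, rfl⟩ hxz
  exact ((Set.ext_iff.1 hxz x).1 ⟨hx, rfl⟩).2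

theorem crs_eq_lift_mk (H : IsCoding E F h j s) (m : {m : ℕ∞ // 1 ≤ m}) :
    crs E F m = Cardinal.lift.{u} (Cardinal.mk {r | m.1 ≤ level h j r}) := by
  have himg : classesWithAtLeast E F m.1 = (fun r => h ⁻¹' {r}) '' {r | m.1 ≤ level h j r} := by
    ext C
    constructor
    · rintro ⟨⟨x, rfl⟩, hm⟩
      have hx : {z | F z x} = h ⁻¹' {h x} := by
        ext z
        exact H.rel_coarse z x
      rw [hx, H.encard_classes_eq_level] at hm
      exact ⟨h x, hm, hx.symm⟩
    · rintro ⟨r, hr, rfl⟩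
      refine ⟨?_, by rwa [H.encard_classes_eq_level]⟩
      -- `1 ≤ m` excludes the reals that label no class.
      obtain ⟨_, x, hx, rfl⟩ := one_le_encard_iff_nonempty.1 (m.2.trans hr)
      refine ⟨x, ?_⟩
      ext z
      change h z = r ↔ F z x
      rw [H.rel_coarse, show h x = r from hx]
  rw [crs, himg]
  have := Cardinal.mk_image_eq_of_injOn_lift (fun r => h ⁻¹' {r}) {r | m.1 ≤ level h j r} (by
    intro r hr t ht hrt
    obtain ⟨_, x, hx, rfl⟩ := one_le_encard_iff_nonempty.1 (m.2.trans hr)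
    exact Eq.trans (Eq.symm hx) ((Set.ext_iff.1 hrt x).1 hx))
  simpa using this

end IsCoding

/-! ### Matching labels without lowering their level -/

/-- A Hall-type matching theorem for nested families of candidate sets. -/
theorem exists_injective_level_le {ι : Type*} {β : Type*} [Countable ι] (ℓ : ι → ℕ∞) (ℓ' : β → ℕ∞)
    (hcard : ∀ x, {z | ℓ x ≤ ℓ z}.encard ≤ {y | ℓ x ≤ ℓ' y}.encard) :
    ∃ f : ι → β, Function.Injective f ∧ ∀ x, ℓ x ≤ ℓ' (f x) := by
  classical
  let T : ι → Set β := fun x => {y | ℓ x ≤ ℓ' y}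
  let P : Set ι := {x | (T x).Finite}
  have hP : P.Finite := by
    rcases P.eq_empty_or_nonempty with h0 | hne
    · rw [h0]
      exact finite_empty
    · obtain ⟨_, ⟨x, hx, rfl⟩, hmin⟩ := (wellFounded_lt (α := ℕ∞)).has_min (ℓ '' P) (hne.image ℓ)
      have hfin : {z | ℓ x ≤ ℓ z}.Finite :=
        encard_lt_top_iff.1 ((hcard x).trans_lt (encard_lt_top_iff.2 hx))
      exact hfin.subset fun z hz => not_lt.1 (hmin _ ⟨z, hz, rfl⟩)
  obtain ⟨e, he⟩ := exists_injective_nat ι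
  -- Infinite candidate sets are cut to this size so that, if `x` has the largest `e` in `S \ P`,
  -- the set `t x` alone is as large as `S`: at most `e x + 1` points lie outside `P`.
  have ht : ∀ x, ∃ t : Finset β, (t : Set β) ⊆ T x ∧ (x ∈ P → (t : Set β) = T x) ∧
      (x ∉ P → t.card = e x + 1 + hP.toFinset.card) := by
    intro x
    by_cases hx : x ∈ P
    · have hx' : (T x).Finite := hx
      exact ⟨hx'.toFinset, by simp, fun _ => by simp, fun h => (h hx).elim⟩
    · have hx' : (T x).Infinite := hx
      obtain ⟨t, h1, h2⟩ := hx'.exists_subset_card_eq (e x + 1 + hP.toFinset.card)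
      exact ⟨t, h1, fun h => (hx h).elim, fun _ => h2⟩
  choose t htT htP htc using ht
  obtain ⟨f, hf, hft⟩ := (Finset.all_card_le_biUnion_card_iff_exists_injective t).1 fun S => by
    by_cases hS : ∃ x ∈ S, x ∉ P
    · obtain ⟨x, hx, hmax⟩ := Finset.exists_max_image (S.filter (· ∉ P)) e (by
        obtain ⟨x, hx, hxP⟩ := hS
        exact ⟨x, Finset.mem_filter.2 ⟨hx, hxP⟩⟩)
      have hxS := Finset.mem_filter.1 hx
      have h1 : (S.filter (· ∉ P)).card ≤ e x + 1 := by
        rw [← Finset.card_image_of_injective _ he, ← Finset.card_range (e x + 1)]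
        refine Finset.card_le_card fun k hk => ?_
        obtain ⟨z, hz, rfl⟩ := Finset.mem_image.1 hk
        exact Finset.mem_range.2 (Nat.lt_succ_of_le (hmax z hz))
      have h2 : (S.filter (· ∈ P)).card ≤ hP.toFinset.card :=
        Finset.card_le_card fun z hz => by simpa using (Finset.mem_filter.1 hz).2
      have h3 := Finset.card_filter_add_card_filter_not (s := S) (· ∈ P)
      have h4 := Finset.card_le_card (Finset.subset_biUnion_of_mem t hxS.1)
      rw [htc x hxS.2] at h4
      omega
    · push Not at hS
      rcases S.eq_empty_or_nonempty with rfl | hne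
      · simp
      · obtain ⟨x, hx, hmin⟩ := Finset.exists_min_image S ℓ hne
        refine le_trans ?_ (Finset.card_le_card (Finset.subset_biUnion_of_mem t hx))
        have h1 : (S : Set ι).encard ≤ (t x : Set β).encard := by
          rw [htP x (hS x hx)]
          exact (encard_le_encard fun z hz => hmin z hz).trans (hcard x)
        rw [encard_coe_eq_coe_finsetCard, encard_coe_eq_coe_finsetCard] at h1
        exact_mod_cast h1
  exact ⟨f, hf, fun x => htT x (hft x)⟩

theorem exists_measurable_injective_into {B : Set ℝ} (hB : MeasurableSet B)
    (hBc : ¬ B.Countable) :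
    ∃ φ : ℝ → ℝ, Measurable φ ∧ Function.Injective φ ∧ ∀ r, φ r ∈ B := by
  have : StandardBorelSpace B := hB.standardBorel
  have hR : ¬ Countable ℝ := not_countable_iff.2 inferInstance
  let e : ℝ ≃ᵐ B := PolishSpace.measurableEquivOfNotCountable hR
    (fun h => hBc (countable_coe_iff.1 h))
  exact ⟨fun r => e r, measurable_subtype_coe.comp e.measurable,
    Subtype.val_injective.comp e.injective, fun r => (e r).2⟩

/-- The points whose candidate set is uncountable can be matched in a Borel way, even if a
countable set of candidates is excluded. -/
theorem exists_measurable_matching_of_uncountable {ℓ ℓ' : ℝ → ℕ∞} (hℓ : Measurable ℓ)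
    (hℓ' : Measurable ℓ') {C : Set ℝ} (hC : C.Countable) :
    ∃ φ : ℝ → ℝ, Measurable φ ∧ InjOn φ {r | ¬ {t | ℓ r ≤ ℓ' t}.Countable} ∧
      ∀ r, ¬ {t | ℓ r ≤ ℓ' t}.Countable → ℓ r ≤ ℓ' (φ r) ∧ φ r ∉ C := by
  have hdiff : ∀ {B : Set ℝ}, ¬ B.Countable → ¬ (B \ C).Countable := fun hB hBC =>
    hB ((hBC.union hC).mono (by rw [sdiff_union_self]; exact subset_union_left))
  by_cases hne : ∃ m : ℕ∞, ¬ {t | m ≤ ℓ' t}.Countable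
  swap
  · push Not at hne
    exact ⟨id, measurable_id, Function.injective_id.injOn, fun r hr => (hr (hne _)).elim⟩
  -- If there is a largest level with uncountably many candidates, one injection into its superlevel
  -- set serves all points.
  by_cases hmax : ∃ M : ℕ∞, ¬ {t | M ≤ ℓ' t}.Countable ∧
      ∀ m : ℕ∞, ¬ {t | m ≤ ℓ' t}.Countable → m ≤ M
  · obtain ⟨M, hM, hMmax⟩ := hmax
    obtain ⟨φ, hφ, hinj, hφB⟩ := exists_measurable_injective_into
      ((hℓ' (MeasurableSet.of_discrete (s := Ici M))).diff hC.measurableSet) (hdiff hM)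
    exact ⟨φ, hφ, hinj.injOn, fun r hr => ⟨(hMmax _ hr).trans (hφB r).1, (hφB r).2⟩⟩
  · push Not at hmax
    have htop : {t | (⊤ : ℕ∞) ≤ ℓ' t}.Countable := by
      by_contra htop
      obtain ⟨m, -, hm⟩ := hmax ⊤ htop
      exact hm.not_ge le_top
    have hunb : ∀ n : ℕ, ∃ m : ℕ∞, (n : ℕ∞) ≤ m ∧ ¬ {t | m ≤ ℓ' t}.Countable := by
      intro n
      induction n with
      | zero =>
        obtain ⟨m, hm⟩ := hne
        exact ⟨m, by simp, hm⟩
      | succ n ih =>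
        obtain ⟨m, hnm, hm⟩ := ih
        obtain ⟨m', hm', hmm'⟩ := hmax m hm
        refine ⟨m', ?_, hm'⟩
        push_cast
        exact Order.add_one_le_of_lt (hnm.trans_lt hmm')
    -- With no largest such level, infinitely many exact finite levels are uncountable. Level `n`
    -- goes into the `n`-th of them, `k n ≥ n`, so images of different levels stay disjoint.
    have hfreq : ∃ᶠ k : ℕ in atTop, ¬ {t | ℓ' t = k}.Countable := by
      refine frequently_atTop.2 fun n => ?_
      by_contra! hcon
      obtain ⟨m, hnm, hm⟩ := hunb n
      refine hm (((countable_iUnion fun k : ℕ => countable_iUnion fun hk : n ≤ k =>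
        hcon k hk).union htop).mono fun t ht => ?_)
      rcases eq_or_ne (ℓ' t) ⊤ with h | h
      · exact Or.inr h.ge
      · obtain ⟨k, hk⟩ := ENat.ne_top_iff_exists.1 h
        refine Or.inl (mem_iUnion.2 ⟨k, mem_iUnion.2 ⟨?_, hk.symm⟩⟩)
        have : (n : ℕ∞) ≤ (k : ℕ∞) := hk ▸ hnm.trans ht
        exact_mod_cast this
    obtain ⟨k, hk, hkc⟩ := extraction_of_frequently_atTop hfreq
    choose Φ hΦ hΦinj hΦB using fun n => exists_measurable_injective_into
      ((hℓ' (measurableSet_singleton ((k n : ℕ) : ℕ∞))).diff hC.measurableSet) (hdiff (hkc n))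
    have hfin : ∀ r, ¬ {t | ℓ r ≤ ℓ' t}.Countable → ((ℓ r).toNat : ℕ∞) = ℓ r := fun r hr =>
      ENat.natCast_toNat fun h => hr (by rw [h]; exact htop)
    have hΦ' : ∀ n r, ℓ' (Φ n r) = (k n : ℕ) := fun n r => (hΦB n r).1
    refine ⟨fun r => Φ (ℓ r).toNat r, ?_, ?_, fun r hr => ⟨?_, (hΦB _ r).2⟩⟩
    · exact (measurable_from_prod_countable_left (f := fun p : ℝ × ℕ∞ => Φ p.2.toNat p.1)
        fun n => hΦ n.toNat).comp (measurable_id.prodMk hℓ)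
    · intro r _ t _ hrt
      have hn : (ℓ r).toNat = (ℓ t).toNat := by
        have := congrArg ℓ' hrt
        simp only [hΦ'] at this
        exact hk.injective (by exact_mod_cast this)
      simp only [hn] at hrt
      exact hΦinj _ hrt
    · rw [hΦ', ← hfin r hr]
      exact_mod_cast hk.id_le _

/-- The least level in `Q` shows that `Q` is countable, so its Hall matching may overwrite a Borel
map that avoids the matched values. -/
theorem exists_measurable_matching {ℓ ℓ' : ℝ → ℕ∞} (hℓ : Measurable ℓ) (hℓ' : Measurable ℓ')
    (hcard : ∀ m : ℕ∞, 1 ≤ m →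
      Cardinal.mk {r | m ≤ ℓ r} ≤ Cardinal.mk {t | m ≤ ℓ' t}) :
    ∃ φ : ℝ → ℝ, Measurable φ ∧ InjOn φ {r | 1 ≤ ℓ r} ∧ ∀ r, 1 ≤ ℓ r → ℓ r ≤ ℓ' (φ r) := by
  classical
  let Q : Set ℝ := {r | 1 ≤ ℓ r ∧ {t | ℓ r ≤ ℓ' t}.Countable}
  have hQ : Q.Countable := by
    rcases Q.eq_empty_or_nonempty with h0 | hne
    · rw [h0]
      exact countable_empty
    · obtain ⟨_, ⟨x, hx, rfl⟩, hmin⟩ := (wellFounded_lt (α := ℕ∞)).has_min (ℓ '' Q) (hne.image ℓ)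
      have hc : {z | ℓ x ≤ ℓ z}.Countable := by
        rw [← Cardinal.le_aleph0_iff_set_countable]
        exact (hcard _ hx.1).trans (Cardinal.le_aleph0_iff_set_countable.2 hx.2)
      exact hc.mono fun z hz => not_lt.1 (hmin _ ⟨z, hz, rfl⟩)
  have : Countable Q := hQ.to_subtype
  obtain ⟨ψ, hψ, hψℓ⟩ := exists_injective_level_le (fun x : Q => ℓ x) ℓ' fun x => by
    obtain ⟨i⟩ := Cardinal.le_def _ _ |>.1 (hcard _ x.2.1)
    refine le_trans ?_ i.encard_le
    rw [← Subtype.val_injective.encard_image]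
    exact encard_le_encard (by rintro _ ⟨z, hz, rfl⟩; exact hz)
  obtain ⟨φ, hφ, hinj, hφℓ⟩ := exists_measurable_matching_of_uncountable hℓ hℓ'
    (countable_range ψ)
  have hR : ∀ {r}, 1 ≤ ℓ r → r ∉ Q → ¬ {t | ℓ r ≤ ℓ' t}.Countable := fun h1 h2 h3 => h2 ⟨h1, h3⟩
  refine ⟨fun r => if h : r ∈ Q then ψ ⟨r, h⟩ else φ r,
    hφ.measurable_of_countable_ne (hQ.mono fun r hr => ?_), ?_, fun r hr => ?_⟩
  · by_contra h
    exact hr (by simp [h])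
  · intro r hr t ht hrt
    by_cases h1 : r ∈ Q <;> by_cases h2 : t ∈ Q <;> simp only [h1, h2, dite_true, dite_false] at hrt
    · exact congrArg Subtype.val (hψ hrt)
    · exact ((hφℓ t (hR ht h2)).2 ⟨_, hrt⟩).elim
    · exact ((hφℓ r (hR hr h1)).2 ⟨_, hrt.symm⟩).elim
    · exact hinj (hR hr h1) (hR ht h2) hrt
  · by_cases h1 : r ∈ Q
    · simpa only [h1, dite_true] using hψℓ ⟨r, h1⟩
    · simpa only [h1, dite_false] using (hφℓ r (hR hr h1)).1

/-! ### From label maps to reductions and back -/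

section

variable {X : Type u} {Y : Type v} [MeasurableSpace X] [MeasurableSpace Y] {E F : Setoid X}
  {E' F' : Setoid Y} {h : X → ℝ} {j : X → ℕ} {s : ℕ → ℝ → X} {h' : Y → ℝ} {j' : Y → ℕ}
  {s' : ℕ → ℝ → Y}

theorem IsCoding.level_le_of_isReduction (H : IsCoding E F h j s) (H' : IsCoding E' F' h' j' s')
    {f : X → Y} (hE : IsReduction E E' f) (hF : IsReduction F F' f) (x : X) :
    level h j (h x) ≤ level h' j' (h' (f x)) := by
  have hex : ∀ n : ℕ, ∃ z : X, n ∈ j '' (h ⁻¹' {h x}) → h z = h x ∧ j z = n := by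
    intro n
    by_cases hn : n ∈ j '' (h ⁻¹' {h x})
    · obtain ⟨z, hz, hzn⟩ := hn
      exact ⟨z, fun _ => ⟨hz, hzn⟩⟩
    · exact ⟨x, fun h => (hn h).elim⟩
  choose z hz using hex
  have hlab : ∀ n ∈ j '' (h ⁻¹' {h x}), h' (f (z n)) = h' (f x) := fun n hn =>
    (H'.rel_coarse _ _).1 ((hF _ _).1 ((H.rel_coarse _ _).2 (hz n hn).1))
  refine encard_le_encard_of_injOn (f := fun n => j' (f (z n)))
    (fun n hn => ⟨_, hlab n hn, rfl⟩) fun n hn m hm hnm => ?_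
  have := (hE _ _).2 ((H'.rel_fine _ _).2 ⟨(hlab n hn).trans (hlab m hm).symm, hnm⟩)
  rw [← (hz n hn).2, ← (hz m hm).2]
  exact ((H.rel_fine _ _).1 this).2

theorem IsCoding.mk_le_of_simReducible (H : IsCoding E F h j s) (H' : IsCoding E' F' h' j' s')
    (hred : SimReducible E F E' F') {m : ℕ∞} (hm : 1 ≤ m) :
    Cardinal.mk {r | m ≤ level h j r} ≤ Cardinal.mk {t | m ≤ level h' j' t} := by
  obtain ⟨f, -, hE, hF⟩ := hred
  have hex : ∀ r : {r | m ≤ level h j r}, ∃ x, h x = r := by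
    rintro ⟨r, hr⟩
    obtain ⟨_, x, hx, -⟩ := one_le_encard_iff_nonempty.1 (hm.trans hr)
    exact ⟨x, hx⟩
  choose x hx using hex
  refine Cardinal.mk_le_of_injective (f := fun r => ⟨h' (f (x r)), ?_⟩) fun r t hrt => ?_
  · have hr : m ≤ level h j r := r.2
    rw [← hx r] at hr
    exact hr.trans (H.level_le_of_isReduction H' hE hF (x r))
  · have := (hF _ _).2 ((H'.rel_coarse _ _).2 (congrArg Subtype.val hrt))
    exact Subtype.ext ((hx r).symm.trans (((H.rel_coarse _ _).1 this).trans (hx t)))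

/-- The map keeps the index `j` and moves the label by `φ`. The target class exists because `φ` does
not lower the level. -/
theorem IsCoding.simReducible_of_mk_le (H : IsCoding E F h j s) (H' : IsCoding E' F' h' j' s')
    (hcard : ∀ m : ℕ∞, 1 ≤ m →
      Cardinal.mk {r | m ≤ level h j r} ≤ Cardinal.mk {t | m ≤ level h' j' t}) :
    SimReducible E F E' F' := by
  obtain ⟨φ, hφ, hinj, hφℓ⟩ := exists_measurable_matching H.measurable_level H'.measurable_level
    hcard
  have hlt : ∀ x, (j x : ℕ∞) < level h j (h x) := fun x => (H.lt_level_iff _ _).2 ⟨x, rfl, rfl⟩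
  have hone : ∀ x, 1 ≤ level h j (h x) := fun x => Order.one_le_iff_pos.2 ((hlt x).pos)
  have hf : ∀ x, h' (s' (j x) (φ (h x))) = φ (h x) ∧ j' (s' (j x) (φ (h x))) = j x := by
    intro x
    obtain ⟨y, hy, hyφ⟩ := (H'.lt_level_iff _ _).1 ((hlt x).trans_le (hφℓ _ (hone x)))
    rw [← hyφ, ← show j' y = j x from hy]
    exact ⟨H'.label_section y, H'.index_section y⟩
  have hφ_iff : ∀ x z, φ (h x) = φ (h z) ↔ h x = h z := fun x z =>
    ⟨fun hxz => hinj (hone x) (hone z) hxz, fun hxz => by rw [hxz]⟩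
  refine ⟨fun x => s' (j x) (φ (h x)), ?_, fun x z => ?_, fun x z => ?_⟩
  · exact (measurable_from_prod_countable_left (f := fun p : ℝ × ℕ => s' p.2 p.1)
      H'.measurable_section).comp ((hφ.comp H.measurable_label).prodMk H.measurable_index)
  · rw [H.rel_fine, H'.rel_fine, (hf x).1, (hf z).1, (hf x).2, (hf z).2, hφ_iff]
  · rw [H.rel_coarse, H'.rel_coarse, (hf x).1, (hf z).1, hφ_iff]

end

theorem simReducible_iff_crs_le {X : Type u} {Y : Type v} [MeasurableSpace X]
    [StandardBorelSpace X] [MeasurableSpace Y] [StandardBorelSpace Y] {E F : Setoid X}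
    {E' F' : Setoid Y} (hEF : E ≤ F) (hEF' : E' ≤ F') (hE : IsSmooth E) (hF : IsSmooth F)
    (hE' : IsSmooth E') (hF' : IsSmooth F') (cF : IsCountable F) (cF' : IsCountable F') :
    SimReducible E F E' F' ↔ ∀ m : {m : ℕ∞ // 1 ≤ m},
      Cardinal.lift.{v} (crs E F m) ≤ Cardinal.lift.{u} (crs E' F' m) := by
  -- Codings need a point for the default values of sections, so empty spaces are treated apart.
  rcases isEmpty_or_nonempty X with hX | hX
  · refine iff_of_true ⟨fun x => isEmptyElim x, measurable_of_empty _, fun x => isEmptyElim x,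
      fun x => isEmptyElim x⟩ fun m => ?_
    have : IsEmpty (classesWithAtLeast E F m.1) :=
      ⟨fun C => by obtain ⟨_, ⟨x, -⟩, -⟩ := C; exact isEmptyElim x⟩
    rw [crs, Cardinal.mk_eq_zero, Cardinal.lift_zero]
    exact zero_le
  obtain ⟨h, j, s, H⟩ := exists_isCoding hEF hE hF cF
  rcases isEmpty_or_nonempty Y with hY | hY
  · refine iff_of_false (fun ⟨f, _⟩ => hX.elim fun x => isEmptyElim (f x)) fun hle => ?_
    have h0 : IsEmpty (classesWithAtLeast E' F' 1) :=
      ⟨fun C => by obtain ⟨_, ⟨x, -⟩, -⟩ := C; exact isEmptyElim x⟩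
    have := hle ⟨1, le_rfl⟩
    rw [crs, crs, Cardinal.mk_eq_zero (classesWithAtLeast E' F' 1), Cardinal.lift_zero,
      nonpos_iff_eq_zero, Cardinal.lift_eq_zero, Cardinal.mk_eq_zero_iff] at this
    obtain ⟨x⟩ := hX
    refine this.elim ⟨{y | F y x}, ⟨x, rfl⟩, one_le_encard_iff_nonempty.2
      ⟨{y | E y x}, ⟨x, rfl⟩, ?_⟩⟩
    exact fun y hy => hEF hy
  obtain ⟨h', j', s', H'⟩ := exists_isCoding hEF' hE' hF' cF'
  have hcard : (∀ m : {m : ℕ∞ // 1 ≤ m},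
      Cardinal.lift.{v} (crs E F m) ≤ Cardinal.lift.{u} (crs E' F' m)) ↔ ∀ m : ℕ∞, 1 ≤ m →
      Cardinal.mk {r | m ≤ level h j r} ≤ Cardinal.mk {t | m ≤ level h' j' t} := by
    rw [Subtype.forall]
    refine forall₂_congr fun m hm => ?_
    rw [H.crs_eq_lift_mk, H'.crs_eq_lift_mk, Cardinal.lift_lift, Cardinal.lift_lift]
    exact Cardinal.lift_le
  rw [hcard]
  exact ⟨fun hred m hm => H.mk_le_of_simReducible H' hred hm, H.simReducible_of_mk_le H'⟩

end BorelPairs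

theorem theorem5p1 {X : Type u} {Y : Type v}
    [MeasurableSpace X] [StandardBorelSpace X] [MeasurableSpace Y] [StandardBorelSpace Y]
    (E F : Setoid X) (E' F' : Setoid Y)
    (hEF : E ≤ F) (hEF' : E' ≤ F')
    (hE : BorelPairs.IsSmooth E) (hF : BorelPairs.IsSmooth F)
    (hE' : BorelPairs.IsSmooth E') (hF' : BorelPairs.IsSmooth F')
    (cE : BorelPairs.IsCountable E) (cF : BorelPairs.IsCountable F)
    (cE' : BorelPairs.IsCountable E') (cF' : BorelPairs.IsCountable F') :
    (BorelPairs.SimReducible E F E' F' ↔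
      ∀ m : {m : ℕ∞ // 1 ≤ m},
        Cardinal.lift.{v} (BorelPairs.crs E F m) ≤ Cardinal.lift.{u} (BorelPairs.crs E' F' m)) ∧
    (BorelPairs.SimBireducible E F E' F' ↔
      ∀ m : {m : ℕ∞ // 1 ≤ m},
        Cardinal.lift.{v} (BorelPairs.crs E F m) = Cardinal.lift.{u} (BorelPairs.crs E' F' m)) := by
  have h₁ := BorelPairs.simReducible_iff_crs_le hEF hEF' hE hF hE' hF' cF cF'
  have h₂ := BorelPairs.simReducible_iff_crs_le hEF' hEF hE' hF' hE hF cF' cF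
  refine ⟨h₁, ?_⟩
  rw [BorelPairs.SimBireducible, h₁, h₂, ← forall_and]
  exact forall_congr' fun m => le_antisymm_iff.symm
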